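/- Let $G$ be a $\sigma$-compact, locally compact abelian topological group acting continuously on a compact metric space $(X,d)$, and suppose that the action is minimal (every orbit is dense). Let $\pi_{eq}\colon X\to X_{eq}$ be the maximal equicontinuous factor of $(X,G)$, that is, the equicontinuous factor through which every equicontinuous factor of $(X,G)$ factors. Let $m\ge 2$ be an integer. 1. $(X,G)$ is $m$-equicontinuous if and only if $r_M(X,G)\le m-1$. 2. For every $y\in X_{eq}$: $(X,G)$ is cover $m$-equicontinuous if and only if $r_c(X,G)<m$, where $r_c(X,G)$ is computed in the fibre $\pi_{eq}^{-1}(y)$. Here: - $(X,G)$ is *$m$-equicontinuous* if for every $x\in X$ and $\varepsilon>0$ there is $\delta>0$ such that for all $x_1,\dots,x_m$ in the open ball $B_\delta(x)$ and all $g\in G$ there are $i\neq j$ with $d(gx_i,gx_j)<\varepsilon$. - $(X,G)$ is *cover $m$-equicontinuous* if for every $x\in X$ and $\varepsilon>0$ there are an open neighbourhood $U$ of $x$ and a compact set $K\subset G$ such that for all $x_1,\dots,x_m\in U$ the set $A=\{g\in G:\exists\, i\neq j,\ d(gx_i,gx_j)\le\varepsilon\}$ satisfies $KA=G$. - The *maximal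 rank* is $r_M(X,G)=\sup\{|\pi_{eq}^{-1}(y)|:y\in X_{eq}\}$. - The *coincidence rank* $r_c(X,G)$, computed in the fibre over $y\in X_{eq}$, is the supremum of all $n\in\mathbb N$ for which there are $x_1,\dots,x_n\in\pi_{eq}^{-1}(y)$ such that $(x_i,x_j)$ is not proximal for all $i\neq j$; a pair $(x,x')$ is *proximal* if for every $\varepsilon>0$ there is $g\in G$ with $d(gx,gx')<\varepsilon$. Both ranks take values in $\mathbb N\cup\{\infty\}$ (and are $0$ only in the degenerate case of an empty space). -/

import Mathlib

universe u v

namespace TopDyn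

open Set Topology

section Actions

variable (G : Type v) [Group G]

/-- The action of `G` on `Y` is equicontinuous: for every `ε > 0` there is `δ > 0` such that
`d(x, y) < δ` implies `d(g x, g y) < ε` for all `g ∈ G`. -/
def IsEquicontinuousAction (Y : Type u) [MetricSpace Y] [MulAction G Y] : Prop :=
  UniformEquicontinuous (fun (g : G) (y : Y) => g • y)

/-- A factor map: a continuous equivariant surjection. -/
structure IsFactorMap {X : Type*} {Y : Type*} [TopologicalSpace X] [TopologicalSpace Y]
    [MulAction G X] [MulAction G Y] (φ : X → Y) : Prop where
  continuous : Continuous φ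
  surjective : Function.Surjective φ
  map_smul : ∀ (g : G) (x : X), φ (g • x) = g • φ x

/-- `(x, y)` is a proximal pair. -/
def IsProximal {X : Type u} [MetricSpace X] [MulAction G X] (x y : X) : Prop :=
  ∀ ε : ℝ, 0 < ε → ∃ g : G, dist (g • x) (g • y) < ε

/-- `x` is an `m`-equicontinuity point. -/
def IsEquicontinuityPoint {X : Type u} [MetricSpace X] [MulAction G X] (m : ℕ) (x : X) : Prop :=
  ∀ ε : ℝ, 0 < ε → ∃ δ : ℝ, 0 < δ ∧ ∀ p : Fin m → X, (∀ i, p i ∈ Metric.ball x δ) →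
    ∀ g : G, ∃ i j : Fin m, i ≠ j ∧ dist (g • p i) (g • p j) < ε

/-- The action is `m`-equicontinuous: every point is an `m`-equicontinuity point. -/
def IsMEquicontinuous (X : Type u) [MetricSpace X] [MulAction G X] (m : ℕ) : Prop :=
  ∀ x : X, IsEquicontinuityPoint G m x

/-- `A` is `K`-covering: `G = K A`. -/
def IsCoveringSet {G : Type v} [Group G] (K A : Set G) : Prop :=
  ∀ g : G, ∃ k ∈ K, ∃ a ∈ A, k * a = g

/-- `x` is a covering `m`-equicontinuity point. -/
def IsCoveringEquicontinuityPoint [TopologicalSpace G] {X : Type u} [MetricSpace X]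
    [MulAction G X] (m : ℕ) (x : X) : Prop :=
  ∀ ε : ℝ, 0 < ε → ∃ U : Set X, IsOpen U ∧ x ∈ U ∧ ∃ K : Set G, IsCompact K ∧
    ∀ p : Fin m → X, (∀ i, p i ∈ U) →
      IsCoveringSet K {g : G | ∃ i j : Fin m, i ≠ j ∧ dist (g • p i) (g • p j) ≤ ε}

/-- The action is cover `m`-equicontinuous: every point is a covering `m`-equicontinuity point. -/
def IsCoverMEquicontinuous [TopologicalSpace G] (X : Type u) [MetricSpace X] [MulAction G X]
    (m : ℕ) : Prop :=
  ∀ x : X, IsCoveringEquicontinuityPoint G m x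

end Actions

section MaximalEquicontinuousFactor

variable (G : Type v) [Group G] [TopologicalSpace G]
variable (X : Type u) [MetricSpace X] [MulAction G X]

/-- An equicontinuous factor of `(X, G)`: a compact metric space with a continuous equicontinuous
action of `G`, together with a factor map from `X`. -/
structure EquicontinuousFactor where
  carrier : Type u
  [metric : MetricSpace carrier]
  [compact : CompactSpace carrier]
  [action : MulAction G carrier]
  [continuousSMul : ContinuousSMul G carrier]
  equicontinuous : IsEquicontinuousAction G carrier
  map : X → carrier
  isFactorMap : IsFactorMap G map

attribute [instance] EquicontinuousFactor.metric EquicontinuousFactor.compact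
  EquicontinuousFactor.action EquicontinuousFactor.continuousSMul

/-- Two points are identified when no equicontinuous factor of `(X, G)` separates them. -/
def eqStructureRelation : Setoid X where
  r x y := ∀ F : EquicontinuousFactor G X, F.map x = F.map y
  iseqv := ⟨fun _ _ => rfl, fun h F => (h F).symm, fun h h' F => (h F).trans (h' F)⟩

/-- The maximal equicontinuous factor `X_eq` of `(X, G)`, as a quotient of `X`. Its metric and its
action are constructed below, and `MaxEquicontinuousFactor.isMaximal` shows that it is an
equicontinuous factor through which every equicontinuous factor of `(X, G)` factors. -/
def MaxEquicontinuousFactor : Type u := Quotient (eqStructureRelation G X)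

/-- The factor map `π_eq : X → X_eq`. -/
def piEq (x : X) : MaxEquicontinuousFactor G X := Quotient.mk (eqStructureRelation G X) x

namespace MaxEquicontinuousFactor

variable {G X}

theorem piEq_surjective : Function.Surjective (piEq G X) := Quotient.mk_surjective

theorem piEq_eq_iff {x y : X} :
    piEq G X x = piEq G X y ↔ ∀ F : EquicontinuousFactor G X, F.map x = F.map y :=
  Quotient.eq (r := eqStructureRelation G X)

/-- The induced action `g π_eq(x) = π_eq(g x)`. -/
instance : MulAction G (MaxEquicontinuousFactor G X) where
  smul g := Quotient.map (g • ·) fun x y h F => by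
    change F.map (g • x) = F.map (g • y)
    rw [F.isFactorMap.map_smul, F.isFactorMap.map_smul, h F]
  one_smul := by
    rintro ⟨x⟩
    exact congrArg (piEq G X) (one_smul G x)
  mul_smul := by
    rintro g h ⟨x⟩
    exact congrArg (piEq G X) (mul_smul g h x)

theorem piEq_smul (g : G) (x : X) : piEq G X (g • x) = g • piEq G X x := rfl

/-- The map induced on `X_eq` by an equicontinuous factor. -/
def desc (F : EquicontinuousFactor G X) : MaxEquicontinuousFactor G X → F.carrier :=
  Quotient.lift F.map fun _ _ h => h F

theorem desc_piEq (F : EquicontinuousFactor G X) (x : X) : desc F (piEq G X x) = F.map x := rfl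

theorem desc_smul (F : EquicontinuousFactor G X) (g : G) (y : MaxEquicontinuousFactor G X) :
    desc F (g • y) = g • desc F y := by
  obtain ⟨x, rfl⟩ := piEq_surjective y
  exact F.isFactorMap.map_smul g x

/-- The quotient topology on `X_eq`. -/
abbrev quotientTopology : TopologicalSpace (MaxEquicontinuousFactor G X) :=
  TopologicalSpace.coinduced (piEq G X) inferInstance

section Compact

variable [CompactSpace X]

/-- Countably many equicontinuous factors already separate the points of `X_eq`. -/
theorem exists_countable_separating (G : Type v) [Group G] [TopologicalSpace G]
    (X : Type u) [MetricSpace X] [MulAction G X] [CompactSpace X] :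
    ∃ T : Set (EquicontinuousFactor G X), T.Countable ∧
      Function.Injective
        (fun (y : MaxEquicontinuousFactor G X) (F : T) => desc (F : EquicontinuousFactor G X) y) := by
  obtain ⟨T, hT, hU⟩ := TopologicalSpace.isOpen_iUnion_countable
    (fun F : EquicontinuousFactor G X => {p : X × X | F.map p.1 ≠ F.map p.2})
    (fun F => isOpen_ne_fun (F.isFactorMap.continuous.comp continuous_fst)
      (F.isFactorMap.continuous.comp continuous_snd))
  refine ⟨T, hT, fun y y' h => ?_⟩
  obtain ⟨x, rfl⟩ := piEq_surjective y
  obtain ⟨x', rfl⟩ := piEq_surjective y'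
  rw [piEq_eq_iff]
  by_contra! hne
  obtain ⟨F, hF⟩ := hne
  have hmem : (x, x') ∈ ⋃ F : EquicontinuousFactor G X,
      {p : X × X | F.map p.1 ≠ F.map p.2} := mem_iUnion.2 ⟨F, hF⟩
  rw [← hU] at hmem
  obtain ⟨F', hF', hne'⟩ := mem_iUnion₂.1 hmem
  exact hne' (congrFun h ⟨F', hF'⟩)

theorem isEmbedding_of_injective (T : Set (EquicontinuousFactor G X))
    (hT : Function.Injective
      (fun (y : MaxEquicontinuousFactor G X) (F : T) => desc (F : EquicontinuousFactor G X) y)) :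
    @Topology.IsEmbedding _ _ quotientTopology _
      (fun (y : MaxEquicontinuousFactor G X) (F : T) => desc (F : EquicontinuousFactor G X) y) := by
  letI : TopologicalSpace (MaxEquicontinuousFactor G X) := quotientTopology
  haveI : CompactSpace (MaxEquicontinuousFactor G X) :=
    piEq_surjective.compactSpace continuous_coinduced_rng
  refine (Continuous.isClosedEmbedding ?_ hT).isEmbedding
  exact continuous_coinduced_dom.2
    (continuous_pi fun F => F.1.isFactorMap.continuous)

theorem metrizable :
    @TopologicalSpace.MetrizableSpace (MaxEquicontinuousFactor G X) quotientTopology := by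
  letI : TopologicalSpace (MaxEquicontinuousFactor G X) := quotientTopology
  obtain ⟨T, hT, hinj⟩ := exists_countable_separating G X
  haveI : Countable T := hT.to_subtype
  haveI : TopologicalSpace.MetrizableSpace
      ((F : T) → (F : EquicontinuousFactor G X).carrier) := UniformSpace.metrizableSpace
  exact (isEmbedding_of_injective T hinj).metrizableSpace

/-- A metric on `X_eq` that induces the quotient topology. -/
noncomputable instance : MetricSpace (MaxEquicontinuousFactor G X) :=
  @TopologicalSpace.metrizableSpaceMetric _ quotientTopology metrizable

theorem continuous_piEq : Continuous (piEq G X) := continuous_coinduced_rng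

instance : CompactSpace (MaxEquicontinuousFactor G X) :=
  piEq_surjective.compactSpace continuous_piEq

theorem isFactorMap_piEq : IsFactorMap G (piEq G X) :=
  ⟨continuous_piEq, piEq_surjective, piEq_smul⟩

instance : ContinuousSMul G (MaxEquicontinuousFactor G X) := by
  obtain ⟨T, -, hinj⟩ := exists_countable_separating G X
  exact (isEmbedding_of_injective T hinj).isInducing.continuousSMul (f := (id : G → G))
    continuous_id (fun {g y} => funext fun F => desc_smul F.1 g y)

theorem isEquicontinuousAction : IsEquicontinuousAction G (MaxEquicontinuousFactor G X) := by
  obtain ⟨T, -, hinj⟩ := exists_countable_separating G X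
  have hemb : Topology.IsEmbedding (fun (y : MaxEquicontinuousFactor G X) (F : T) =>
      desc (F : EquicontinuousFactor G X) y) := isEmbedding_of_injective T hinj
  have huc : IsUniformInducing (fun (y : MaxEquicontinuousFactor G X) (F : T) =>
      desc (F : EquicontinuousFactor G X) y) :=
    isUniformInducing_iff_uniformSpace.2
      (unique_uniformity_of_compact hemb.eq_induced.symm rfl)
  unfold IsEquicontinuousAction
  rw [huc.uniformEquicontinuous_iff]
  refine uniformEquicontinuous_iInf_rng.2 fun F => ?_
  letI : UniformSpace ((F : T) → (F : EquicontinuousFactor G X).carrier) :=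
    UniformSpace.comap (Function.eval F) inferInstance
  have hF : IsUniformInducing (Function.eval F :
      ((F : T) → (F : EquicontinuousFactor G X).carrier) → _) :=
    isUniformInducing_iff_uniformSpace.2 rfl
  rw [hF.uniformEquicontinuous_iff]
  have hc : UniformContinuous (desc F.1) :=
    CompactSpace.uniformContinuous_of_continuous
      (continuous_coinduced_dom.2 F.1.isFactorMap.continuous)
  intro V hV
  filter_upwards [hc (F.1.equicontinuous V hV)] with p hp g
  have := hp g
  simp only [Function.comp, Function.eval, desc_smul]
  exact this

/-- `X_eq` is an equicontinuous factor of `(X, G)` and every equicontinuous factor of `(X, G)` is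
a factor of `X_eq`, compatibly with the factor maps. -/
theorem isMaximal :
    IsFactorMap G (piEq G X) ∧ IsEquicontinuousAction G (MaxEquicontinuousFactor G X) ∧
      ∀ (Y : Type u) [MetricSpace Y] [CompactSpace Y] [MulAction G Y] [ContinuousSMul G Y]
        (φ : X → Y), IsFactorMap G φ → IsEquicontinuousAction G Y →
          ∃ ψ : MaxEquicontinuousFactor G X → Y, IsFactorMap G ψ ∧ ∀ x, ψ (piEq G X x) = φ x := by
  refine ⟨isFactorMap_piEq, isEquicontinuousAction, ?_⟩
  intro Y _ _ _ _ φ hφ hY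
  let F : EquicontinuousFactor G X :=
    { carrier := Y, equicontinuous := hY, map := φ, isFactorMap := hφ }
  refine ⟨desc F, ⟨continuous_coinduced_dom.2 hφ.continuous, fun y => ?_, desc_smul F⟩,
    fun x => rfl⟩
  obtain ⟨x, rfl⟩ := hφ.surjective y
  exact ⟨piEq G X x, rfl⟩

end Compact

end MaxEquicontinuousFactor

/-- The maximal rank `r_M`: the supremum of the cardinalities of the fibres of `π_eq`. -/
noncomputable def maximalRank : ℕ∞ :=
  ⨆ y : MaxEquicontinuousFactor G X, (piEq G X ⁻¹' {y}).encard

variable {X} in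
/-- The coincidence rank `r_c` measured in the fibre of `π_eq` over `y`: the supremum of all `n`
such that the fibre contains `n` pairwise non-proximal points. -/
noncomputable def coincidenceRank (y : MaxEquicontinuousFactor G X) : ℕ∞ :=
  ⨆ (n : ℕ) (_ : ∃ x : Fin n → X, (∀ i, piEq G X (x i) = y) ∧
    ∀ i j, i ≠ j → ¬ IsProximal G (x i) (x j)), (n : ℕ∞)

end MaximalEquicontinuousFactor

end TopDyn

/-! The crux is `exists_smul_mem_of_piEq_eq`: a finite tuple in one fibre of `π_eq` has arbitrarily
small perturbations that a single group element carries into any prescribed nonempty open set `U`.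
Commutativity supplies an invariant probability measure, which has full support by minimality. For a
closed invariant `W ⊆ Z × X`, the measure of the section `W_x` is upper semicontinuous and constant
on orbits, hence constant; so `x ↦ W_x` is continuous into the measure algebra, with an invariant
pulled-back distance. It therefore factors through `π_eq`: sections over one fibre agree up to null
sets, and an open set inside one lies inside all. Replacing coordinates one at a time spreads the
tuples from `U` over whole fibres.

Given this, `m` distinct points in a fibre contradict `m`-equicontinuity, and `m` pairwise
non-proximal ones contradict the cover version. Conversely, if either property fails at a point,
translates of shrinking tuples accumulate at a separated tuple, which lies in one fibre because
`X_eq` is equicontinuous. In the cover case the separation persists along the orbit, so minimality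
moves the tuple to any chosen fibre. -/

namespace TopDyn

open Set Topology Filter MeasureTheory
open scoped symmDiff ENNReal Pointwise

/-! ### Invariant measures of abelian actions and their support -/

section InvariantMeasure

variable {X : Type*} [MetricSpace X] [MeasurableSpace X] [BorelSpace X]

/-- The average of the images of a probability measure under the first `n + 1` iterates of a
continuous map is a probability measure. -/
theorem exists_average_iterates {f : X → X} (hf : Continuous f) (μ : ProbabilityMeasure X) (n : ℕ) :
    ∃ ν : ProbabilityMeasure X, (ν : Measure X) =
      ((n : ℝ≥0∞) + 1)⁻¹ • ∑ i ∈ Finset.range (n + 1), (μ : Measure X).map f^[i] := by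
  refine ⟨⟨_, ⟨?_⟩⟩, rfl⟩
  have h (i : ℕ) : ((μ : Measure X).map f^[i]) univ = 1 := by
    rw [Measure.map_apply (hf.iterate i).measurable MeasurableSet.univ, preimage_univ, measure_univ]
  simp only [Measure.smul_apply, Measure.finsetSum_apply, h, smul_eq_mul]
  simp only [Finset.sum_const, Finset.card_range, nsmul_eq_mul, mul_one, Nat.cast_add, Nat.cast_one]
  exact ENNReal.inv_mul_cancel (by simp) (by simp)

variable [CompactSpace X]

/-- A nonempty closed set of probability measures that is stable under averaging along the iterates
of a continuous map contains an invariant measure. -/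
theorem exists_map_eq_of_closed_of_average {f : X → X} (hf : Continuous f)
    {C : Set (ProbabilityMeasure X)} (hC : IsClosed C) (hne : C.Nonempty)
    (hav : ∀ μ ∈ C, ∀ (n : ℕ) (ν : ProbabilityMeasure X), (ν : Measure X) =
      ((n : ℝ≥0∞) + 1)⁻¹ • ∑ i ∈ Finset.range (n + 1), (μ : Measure X).map f^[i] → ν ∈ C) :
    ∃ ν ∈ C, ν.map hf.aemeasurable = ν := by
  obtain ⟨μ, hμ⟩ := hne
  choose ν hν using exists_average_iterates hf μ
  have hνC (n : ℕ) : ν n ∈ C := hav μ hμ n _ (hν n)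
  obtain ⟨ν', hν', hlim⟩ := hC.isCompact.ultrafilter_le_nhds ((hyperfilter ℕ).map ν)
    (le_principal_iff.2 (Eventually.of_forall hνC : ∀ᶠ n in hyperfilter ℕ, ν n ∈ C))
  have hlim : Tendsto ν (hyperfilter ℕ) (𝓝 ν') := hlim
  refine ⟨ν', hν', ?_⟩
  have hlim2 : Tendsto (fun n => (ν n).map hf.aemeasurable) (hyperfilter ℕ)
      (𝓝 (ν'.map hf.aemeasurable)) := ((ProbabilityMeasure.continuous_map hf).tendsto _).comp hlim
  refine tendsto_nhds_unique hlim2 ?_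
  rw [ProbabilityMeasure.tendsto_iff_forall_integral_tendsto] at hlim ⊢
  intro φ
  have hint (i : ℕ) : Integrable (fun x => φ (f^[i] x)) (μ : Measure X) :=
    (φ.compContinuous ⟨_, hf.iterate i⟩).integrable _
  have hformula (ψ : BoundedContinuousFunction X ℝ) (n : ℕ) : ∫ x, ψ x ∂(ν n : Measure X) =
      ((n : ℝ) + 1)⁻¹ * ∑ i ∈ Finset.range (n + 1), ∫ x, ψ (f^[i] x) ∂(μ : Measure X) := by
    rw [hν n, integral_smul_measure, integral_finsetSum_measure]
    · simp only [smul_eq_mul]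
      congr 1
      · rw [ENNReal.toReal_inv]; norm_cast
      · exact Finset.sum_congr rfl fun i _ =>
          integral_map (hf.iterate i).aemeasurable ψ.continuous.aestronglyMeasurable
    · intro i _
      have := Measure.isProbabilityMeasure_map (μ := (μ : Measure X)) (hf.iterate i).aemeasurable
      exact ψ.integrable _
  -- Pushing the average forward shifts the sum by one index, so only the two end terms survive,
  -- with weight `1 / (n + 1)`.
  have hdiff (n : ℕ) : ∫ x, φ x ∂((ν n).map hf.aemeasurable : Measure X) =
      ∫ x, φ x ∂(ν n : Measure X) + ((n : ℝ) + 1)⁻¹ *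
        (∫ x, φ (f^[n + 1] x) ∂(μ : Measure X) - ∫ x, φ x ∂(μ : Measure X)) := by
    rw [ProbabilityMeasure.toMeasure_map,
      integral_map hf.aemeasurable φ.continuous.aestronglyMeasurable]
    have := hformula (φ.compContinuous ⟨f, hf⟩) n
    simp only [BoundedContinuousFunction.compContinuous_apply, ContinuousMap.coe_mk] at this
    rw [this, hformula φ, ← mul_add]
    congr 1
    simp only [← Function.iterate_succ_apply' f]
    rw [Finset.sum_range_succ, Finset.sum_range_succ' (fun i => ∫ x, φ (f^[i] x) ∂(μ : Measure X))]
    simp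
  have hzero : Tendsto (fun n : ℕ => ((n : ℝ) + 1)⁻¹ *
      (∫ x, φ (f^[n + 1] x) ∂(μ : Measure X) - ∫ x, φ x ∂(μ : Measure X)))
      (hyperfilter ℕ) (𝓝 0) := by
    refine Tendsto.mono_left ?_ (Nat.hyperfilter_le_atTop)
    have hb (n : ℕ) : |∫ x, φ (f^[n] x) ∂(μ : Measure X)| ≤ ‖φ‖ := by
      have := norm_integral_le_of_norm_le_const (μ := (μ : Measure X))
        (Eventually.of_forall fun x => φ.norm_coe_le_norm (f^[n] x))
      simpa using this
    refine squeeze_zero_norm (a := fun n : ℕ => ((n : ℝ) + 1)⁻¹ * (2 * ‖φ‖)) (fun n => ?_) ?_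
    · rw [norm_mul, norm_inv, Real.norm_of_nonneg (by positivity : (0 : ℝ) ≤ (n : ℝ) + 1)]
      gcongr
      have h0 := hb 0
      simp only [Function.iterate_zero, id] at h0
      calc _ ≤ _ := norm_sub_le _ _
        _ ≤ _ := by simp only [Real.norm_eq_abs]; linarith [hb (n + 1)]
    · have h := (tendsto_one_div_add_atTop_nhds_zero_nat (𝕜 := ℝ)).mul_const (2 * ‖φ‖)
      simpa using h
  have := (hlim φ).add hzero
  rw [add_zero] at this
  exact this.congr fun n => (hdiff n).symm

/-- A continuous action of an abelian group on a nonempty compact metric space has an invariant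
probability measure. -/
theorem exists_invariant_probabilityMeasure (G : Type*) [CommGroup G] [MulAction G X]
    [ContinuousConstSMul G X] [Nonempty X] :
    ∃ μ : ProbabilityMeasure X,
      ∀ g : G, MeasurePreserving (fun x : X => g • x) (μ : Measure X) μ := by
  have hcont (g : G) : Continuous fun x : X => g • x := continuous_const_smul g
  let F : G → Set (ProbabilityMeasure X) := fun g => {μ | μ.map (hcont g).aemeasurable = μ}
  have hF (g : G) : IsClosed (F g) :=
    isClosed_eq (ProbabilityMeasure.continuous_map (hcont g)) continuous_id
  have hmem (g : G) (μ : ProbabilityMeasure X) :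
      μ ∈ F g ↔ (μ : Measure X).map (fun x => g • x) = μ := by
    rw [← ProbabilityMeasure.toMeasure_map μ (hcont g).aemeasurable]
    exact Subtype.ext_iff
  -- Since `g` commutes with the elements of `S`, averaging along `g` preserves their common fixed
  -- set. Compactness then passes from finite subsets to all of `G`.
  have hfin (S : Finset G) : (⋂ g ∈ S, F g).Nonempty := by
    classical
    induction S using Finset.induction_on with
    | empty =>
      obtain ⟨x⟩ := ‹Nonempty X›
      refine ⟨⟨Measure.dirac x, inferInstance⟩, ?_⟩
      simp only [Finset.notMem_empty, iInter_of_empty, iInter_univ]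
      exact mem_univ _
    | insert g S _ ih =>
      obtain ⟨ν, hν, hνg⟩ := exists_map_eq_of_closed_of_average (hcont g)
        (isClosed_biInter fun h (_ : h ∈ S) => hF h) ih (by
          intro μ hμ n ν hν
          simp only [mem_iInter, hmem] at hμ ⊢
          intro h hh
          rw [hν, Measure.map_smul, ← Measure.mapₗ_apply_of_measurable (hcont h).measurable, map_sum]
          congr 1
          refine Finset.sum_congr rfl fun i _ => ?_
          have hi := ((hcont g).iterate i).measurable
          rw [Measure.mapₗ_apply_of_measurable (hcont h).measurable,
            Measure.map_map (hcont h).measurable hi]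
          have hcomm : (fun x : X => h • x) ∘ (fun x : X => g • x)^[i] =
              (fun x : X => g • x)^[i] ∘ (fun x : X => h • x) := by
            have : Function.Commute (fun x : X => h • x) (fun x : X => g • x) :=
              fun x => smul_comm h g x
            exact (this.iterate_right i).comp_eq
          rw [hcomm, ← Measure.map_map hi (hcont h).measurable, hμ h hh])
      refine ⟨ν, ?_⟩
      rw [Finset.set_biInter_insert]
      exact ⟨hνg, hν⟩
  obtain ⟨μ, hμ⟩ := CompactSpace.iInter_nonempty hF hfin
  exact ⟨μ, fun g => ⟨(hcont g).measurable, (hmem g μ).1 (mem_iInter.1 hμ g)⟩⟩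

/-- An invariant probability measure of a minimal action has full support. -/
theorem isOpenPosMeasure_of_isMinimal (G : Type*) [Group G] [MulAction G X]
    [ContinuousConstSMul G X] [MulAction.IsMinimal G X] (μ : Measure X) [IsProbabilityMeasure μ]
    (hμ : ∀ g : G, MeasurePreserving (fun x : X => g • x) μ μ) : μ.IsOpenPosMeasure := by
  refine ⟨fun U hU hne h0 => ?_⟩
  obtain ⟨I, hI⟩ := isCompact_univ.exists_finite_cover_smul G hU hne
  have h1 : μ (⋃ g ∈ I, g • U) = 0 := by
    refine (measure_biUnion_null_iff I.countable_toSet).2 fun g _ => ?_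
    rw [← preimage_smul_inv, (hμ g⁻¹).measure_preimage hU.measurableSet.nullMeasurableSet, h0]
  have h2 := measure_mono_null hI h1
  simp at h2

end InvariantMeasure

/-! ### Equicontinuous factors from invariant pseudometrics -/

section RegionalProximality

variable {G : Type v} [Group G] [TopologicalSpace G]
variable {X : Type u} [MetricSpace X] [CompactSpace X] [MulAction G X] [ContinuousSMul G X]

/-- A continuous map to a metric space for which the pulled back distance is invariant is constant
on the fibres of `π_eq`. -/
theorem eq_of_piEq_eq {E : Type u} [MetricSpace E] {Φ : X → E} (hΦ : Continuous Φ)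
    (hiso : ∀ (g : G) (x x' : X), dist (Φ (g • x)) (Φ (g • x')) = dist (Φ x) (Φ x'))
    {x x' : X} (h : piEq G X x = piEq G X x') : Φ x = Φ x' := by
  choose s hs using fun y : range Φ => y.2
  have hwell (g : G) {a b : X} (hab : Φ a = Φ b) : Φ (g • a) = Φ (g • b) :=
    dist_eq_zero.1 (by rw [hiso, hab, dist_self])
  -- The action is defined through chosen preimages; `hwell` makes it independent of the choice.
  let act : MulAction G (range Φ) :=
    { smul := fun g y => ⟨Φ (g • s y), mem_range_self _⟩
      one_smul := fun y => Subtype.ext (by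
        change Φ ((1 : G) • s y) = y
        rw [one_smul, hs])
      mul_smul := fun g k y => Subtype.ext (by
        change Φ ((g * k) • s y) = Φ (g • s ⟨Φ (k • s y), mem_range_self _⟩)
        rw [mul_smul]
        exact hwell g (hs ⟨Φ (k • s y), mem_range_self _⟩).symm) }
  have hcoe (g : G) (y : range Φ) : ((g • y : range Φ) : E) = Φ (g • s y) := rfl
  have hdist (g : G) (y y' : range Φ) : dist (g • y) (g • y') = dist y y' := by
    rw [Subtype.dist_eq, Subtype.dist_eq, hcoe, hcoe, hiso, hs, hs]
  have hcs : ContinuousSMul G (range Φ) := by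
    refine ⟨continuous_iff_continuousAt.2 fun p => ?_⟩
    obtain ⟨g₀, y₀⟩ := p
    refine tendsto_iff_dist_tendsto_zero.2 ?_
    -- Because `G` acts by isometries, joint continuity reduces to continuity of the orbit map of
    -- `y₀`.
    have hb (q : G × range Φ) : dist (q.1 • q.2) (g₀ • y₀) ≤
        dist q.2 y₀ + dist (Φ (q.1 • s y₀)) (Φ (g₀ • s y₀)) := by
      refine (dist_triangle _ (q.1 • y₀) _).trans ?_
      rw [hdist, Subtype.dist_eq (q.1 • y₀)]
      rfl
    have hc : Continuous fun q : G × range Φ =>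
        dist q.2 y₀ + dist (Φ (q.1 • s y₀)) (Φ (g₀ • s y₀)) := by fun_prop
    refine squeeze_zero (fun _ => dist_nonneg) hb ?_
    simpa using hc.tendsto (g₀, y₀)
  have hequi : IsEquicontinuousAction G (range Φ) :=
    Metric.uniformEquicontinuous_iff.2 fun ε hε =>
      ⟨ε, hε, fun y y' hyy g => by rw [hdist]; exact hyy⟩
  have hcomp : CompactSpace (range Φ) := isCompact_iff_compactSpace.1 (isCompact_range hΦ)
  let F : EquicontinuousFactor G X :=
    { carrier := range Φ
      equicontinuous := hequi
      map := rangeFactorization Φ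
      isFactorMap :=
        ⟨hΦ.subtype_mk _, rangeFactorization_surjective, fun g a => Subtype.ext
          (hwell g (hs (rangeFactorization Φ a)).symm)⟩ }
  exact congrArg Subtype.val (MaxEquicontinuousFactor.piEq_eq_iff.1 h F)

/-! ### Sections of closed invariant sets -/

section Sections

/-- The sections of a closed subset of `Z × X` with `Z` compact are upper semicontinuous. -/
theorem eventually_section_subset {Z X : Type*} [TopologicalSpace Z] [CompactSpace Z]
    [TopologicalSpace X] {W : Set (Z × X)} (hW : IsClosed W) {O : Set Z} (hO : IsOpen O)
    {x : X} (hx : {z | (z, x) ∈ W} ⊆ O) : ∀ᶠ x' in 𝓝 x, {z | (z, x') ∈ W} ⊆ O := by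
  have hcl : IsClosed (Prod.snd '' (W ∩ Prod.fst ⁻¹' Oᶜ)) :=
    isClosedMap_snd_of_compactSpace _ (hW.inter (hO.isClosed_compl.preimage continuous_fst))
  have hxm : x ∈ (Prod.snd '' (W ∩ Prod.fst ⁻¹' Oᶜ))ᶜ := by
    rintro ⟨⟨z, _⟩, ⟨hz, hzO⟩, rfl⟩
    exact hzO (hx hz)
  filter_upwards [hcl.isOpen_compl.mem_nhds hxm] with x' hx' z hz
  by_contra hzO
  exact hx' ⟨(z, x'), ⟨hz, hzO⟩, rfl⟩

variable {Z : Type u} [MetricSpace Z] [CompactSpace Z] [MeasurableSpace Z] [BorelSpace Z]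
variable [MulAction G Z] [MulAction.IsMinimal G X]

/-- The sections of a closed invariant subset of `Z × X` over two points with the same image in
the maximal equicontinuous factor coincide up to a set of measure zero. -/
theorem measure_symmDiff_section_eq_zero (ν : Measure Z) [IsFiniteMeasure ν]
    (hν : ∀ g : G, MeasurePreserving (fun z : Z => g • z) ν ν)
    {W : Set (Z × X)} (hW : IsClosed W)
    (hinv : ∀ (g : G) (z : Z) (x : X), (z, x) ∈ W → (g • z, g • x) ∈ W)
    {x x' : X} (h : piEq G X x = piEq G X x') :
    ν ({z | (z, x) ∈ W} ∆ {z | (z, x') ∈ W}) = 0 := by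
  let s : X → Set Z := fun x => {z | (z, x) ∈ W}
  have hcl (a : X) : IsClosed (s a) := hW.preimage (by fun_prop : Continuous fun z : Z => (z, a))
  have hms (a : X) : MeasurableSet (s a) := (hcl a).measurableSet
  have hpre (g : G) (a : X) : (fun z : Z => g • z) ⁻¹' s (g • a) = s a := by
    ext z
    refine ⟨fun hz => ?_, hinv g z a⟩
    have := hinv g⁻¹ _ _ hz
    rwa [inv_smul_smul, inv_smul_smul] at this
  have hmeas (g : G) (a : X) : ν (s (g • a)) = ν (s a) := by
    rw [← (hν g).measure_preimage (hms _).nullMeasurableSet, hpre]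
  -- Minimality brings `a` near `b`, where upper semicontinuity bounds the measure, while moving `a`
  -- does not change it.
  have hle (a b : X) : ν (s a) ≤ ν (s b) := by
    by_contra! hlt
    obtain ⟨O, hsO, hO, hOlt⟩ := (s b).exists_isOpen_lt_of_lt _ hlt
    obtain ⟨V, hV, hVo, hbV⟩ := mem_nhds_iff.1 (eventually_section_subset hW hO hsO)
    obtain ⟨g, hg⟩ := hVo.exists_smul_mem G a ⟨b, hbV⟩
    have := measure_mono (μ := ν) (hV hg)
    exact (this.trans_lt hOlt).ne (hmeas g a)
  have hconst (a b : X) : ν (s a) = ν (s b) := (hle a b).antisymm (hle b a)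
  -- Equal total measure makes the two differences equally large, so the one-sided bound from upper
  -- semicontinuity controls the symmetric difference.
  have hdiff (a b : X) : ν (s a \ s b) = ν (s b \ s a) := by
    have h1 := measure_inter_add_sdiff (μ := ν) (s a) (hms b)
    have h2 := measure_inter_add_sdiff (μ := ν) (s b) (hms a)
    rw [inter_comm, hconst b a, ← h1] at h2
    exact ((ENNReal.add_right_inj (measure_ne_top _ _)).1 h2).symm
  let Ψ : X → MeasuredSets ν := fun a => ⟨s a, hms a⟩
  have hΨ : Continuous Ψ := by
    refine continuous_iff_continuousAt.2 fun a => EMetric.tendsto_nhds.2 fun ε hε => ?_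
    obtain ⟨O, hsO, hO, hOlt⟩ := (s a).exists_isOpen_lt_add (measure_ne_top ν _)
      (ENNReal.half_pos hε.ne').ne'
    filter_upwards [eventually_section_subset hW hO hsO] with b hb
    have hlt : ν (s b \ s a) < ε / 2 := by
      refine (measure_mono (sdiff_subset_sdiff_left hb)).trans_lt ?_
      rw [measure_sdiff hsO (hms a).nullMeasurableSet (measure_ne_top _ _)]
      exact ENNReal.sub_lt_of_lt_add (measure_mono hsO) (by rwa [add_comm])
    rw [MeasuredSets.edist_def]
    calc ν (s b ∆ s a) ≤ ν (s b \ s a) + ν (s a \ s b) := measure_union_le _ _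
      _ < ε / 2 + ε / 2 := by rw [hdiff a b]; exact ENNReal.add_lt_add hlt hlt
      _ = ε := ENNReal.add_halves ε
  have hiso (g : G) (a b : X) : dist (Ψ (g • a)) (Ψ (g • b)) = dist (Ψ a) (Ψ b) := by
    rw [MeasuredSets.dist_def, MeasuredSets.dist_def]
    change ν.real (s (g • a) ∆ s (g • b)) = ν.real (s a ∆ s b)
    rw [measureReal_def, measureReal_def,
      ← (hν g).measure_preimage ((hms _).symmDiff (hms _)).nullMeasurableSet, preimage_symmDiff,
      hpre, hpre]
  -- `MeasuredSets` is only pseudometric; the separation quotient identifies sets that differ by a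
  -- null set.
  have hfac := eq_of_piEq_eq (G := G) (SeparationQuotient.continuous_mk.comp hΨ)
    (fun g a b => (SeparationQuotient.dist_mk _ _).trans
      ((hiso g a b).trans (SeparationQuotient.dist_mk _ _).symm)) h
  have hd : dist (Ψ x) (Ψ x') = 0 := by
    rw [← SeparationQuotient.dist_mk]
    exact dist_eq_zero.2 hfac
  rw [MeasuredSets.dist_def, measureReal_def, ENNReal.toReal_eq_zero_iff] at hd
  exact hd.resolve_right (measure_ne_top _ _)

/-- If the section over `x` of a closed invariant set contains an open set, then so do the sections
over all points with the same image in the maximal equicontinuous factor. -/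
theorem subset_section_of_piEq_eq (ν : Measure Z) [IsFiniteMeasure ν] [ν.IsOpenPosMeasure]
    (hν : ∀ g : G, MeasurePreserving (fun z : Z => g • z) ν ν)
    {W : Set (Z × X)} (hW : IsClosed W)
    (hinv : ∀ (g : G) (z : Z) (x : X), (z, x) ∈ W → (g • z, g • x) ∈ W)
    {x x' : X} (h : piEq G X x = piEq G X x') {V : Set Z} (hV : IsOpen V)
    (hVx : V ⊆ {z | (z, x) ∈ W}) : V ⊆ {z | (z, x') ∈ W} := by
  have hcl : IsClosed {z | (z, x') ∈ W} :=
    hW.preimage (by fun_prop : Continuous fun z : Z => (z, x'))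
  rw [← sdiff_eq_empty]
  refine (hV.sdiff hcl).eq_empty_of_measure_zero (μ := ν) ?_
  refine measure_mono_null ?_ (measure_symmDiff_section_eq_zero ν hν hW hinv h)
  exact (sdiff_subset_sdiff_left hVx).trans subset_union_left

end Sections

/-- The factor map `π_eq` of a minimal action is semi-open. -/
theorem interior_image_piEq_nonempty [MulAction.IsMinimal G X] {U : Set X} (hU : IsOpen U)
    (hne : U.Nonempty) : (interior (piEq G X '' U)).Nonempty := by
  obtain ⟨x, hx⟩ := hne
  -- A closed ball has closed image. Were its interior empty, finitely many nowhere dense translates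
  -- would cover `X_eq`, against Baire.
  obtain ⟨r, hr, hrU⟩ := Metric.nhds_basis_closedBall.mem_iff.1 (hU.mem_nhds hx)
  obtain ⟨I, hI⟩ := isCompact_univ.exists_finite_cover_smul G (Metric.isOpen_ball (x := x) (ε := r))
    ⟨x, Metric.mem_ball_self hr⟩
  have hc : IsClosed (piEq G X '' Metric.closedBall x r) :=
    (Metric.isClosed_closedBall.isCompact.image
      MaxEquicontinuousFactor.continuous_piEq).isClosed
  by_contra hemp
  have hint : interior (piEq G X '' Metric.closedBall x r) = ∅ := by
    rw [not_nonempty_iff_eq_empty] at hemp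
    exact subset_empty_iff.1 ((interior_mono (image_mono hrU)).trans hemp.subset)
  have hcov : (⋃ g ∈ I, g • (piEq G X '' Metric.closedBall x r)) = univ := by
    refine eq_univ_of_forall fun y => ?_
    obtain ⟨a, rfl⟩ := MaxEquicontinuousFactor.piEq_surjective y
    obtain ⟨g, hg, b, hb, rfl⟩ := mem_iUnion₂.1 (hI (mem_univ a))
    exact mem_iUnion₂.2 ⟨g, hg, _, ⟨b, Metric.ball_subset_closedBall hb, rfl⟩, rfl⟩
  have hemp' : interior (⋃ g ∈ I, g • (piEq G X '' Metric.closedBall x r)) = ∅ := by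
    have : Nonempty (MaxEquicontinuousFactor G X) := ⟨piEq G X x⟩
    refine interior_eq_empty_iff_dense_compl.2 ?_
    simp only [compl_iUnion]
    refine dense_biInter_of_isOpen (fun g _ => (hc.smul g).isOpen_compl) I.countable_toSet
      fun g _ => ?_
    rw [← interior_eq_empty_iff_dense_compl, interior_smul, hint, smul_set_empty]
  rw [hcov, interior_univ] at hemp'
  exact (hemp' ▸ mem_univ (piEq G X x) : piEq G X x ∈ (∅ : Set _))

end RegionalProximality

/-! ### Tuples in a fibre of the maximal equicontinuous factor -/

section Abelian

variable {G : Type v} [CommGroup G] [TopologicalSpace G]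
variable {X : Type u} [MetricSpace X] [CompactSpace X] [MulAction G X] [ContinuousSMul G X]
  [MulAction.IsMinimal G X]

/-- Let `U` be a nonempty open set and let `B` be the preimage of the interior of `π_eq(U)`. Then a
closed invariant set of tuples that contains all tuples from `U` contains all tuples from `B`. -/
theorem pi_preimage_interior_subset {m : ℕ} {U : Set X} (hU : IsOpen U)
    {W : Set (Fin m → X)} (hW : IsClosed W) (hinv : ∀ (g : G), ∀ z ∈ W, g • z ∈ W)
    (hUW : univ.pi (fun _ => U) ⊆ W) :
    univ.pi (fun _ => piEq G X ⁻¹' interior (piEq G X '' U)) ⊆ W := by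
  classical
  rcases isEmpty_or_nonempty X with hX | hX
  · intro z hz
    exact hUW fun i _ => (hX.false (z i)).elim
  borelize X
  obtain ⟨μ, hμ⟩ := exists_invariant_probabilityMeasure (X := X) G
  have hpos := isOpenPosMeasure_of_isMinimal G (μ : Measure X) hμ
  have hpi (g : G) : MeasurePreserving (fun z : Fin m → X => g • z)
      (Measure.pi fun _ => (μ : Measure X)) (Measure.pi fun _ => (μ : Measure X)) :=
    measurePreserving_pi _ _ fun _ => hμ g
  set B := piEq G X ⁻¹' interior (piEq G X '' U)
  have hB : IsOpen B := isOpen_interior.preimage MaxEquicontinuousFactor.continuous_piEq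
  have key (S : Finset (Fin m)) : univ.pi (fun i => if i ∈ S then B else U) ⊆ W := by
    induction S using Finset.induction_on with
    | empty => simpa using hUW
    | insert i S hi ih =>
      intro z hz
      have hzi : z i ∈ B := by simpa using hz i (mem_univ i)
      obtain ⟨u, hu, hπ⟩ := interior_subset hzi
      -- Slot `i` of the first component is a dummy, overwritten by the second. It is left free in
      -- `V`, so `V` is open in the full product, and the section over `u ∈ U` contains it by
      -- induction.
      let W' : Set ((Fin m → X) × X) := {p | Function.update p.1 i p.2 ∈ W}
      have hW' : IsClosed W' :=
        hW.preimage (continuous_fst.update i continuous_snd)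
      let V : Set (Fin m → X) := univ.pi fun j => if j = i then univ else if j ∈ S then B else U
      have hV : IsOpen V := isOpen_set_pi finite_univ fun j _ => by split_ifs <;> simp [hB, hU]
      have hVW : V ⊆ {w | (w, z i) ∈ W'} := by
        refine subset_section_of_piEq_eq (G := G) _ hpi hW' (fun g w a hw => ?_) hπ hV
          fun w hw => ih fun j _ => ?_
        · have hup : Function.update (g • w) i (g • a) = g • Function.update w i a := by
            ext j
            by_cases hj : j = i
            · subst hj; simp
            · simp [hj]
          change Function.update (g • w) i (g • a) ∈ W
          rw [hup]
          exact hinv g _ hw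
        · have hwj := hw j (mem_univ j)
          by_cases hj : j = i
          · subst hj; simpa [hi] using hu
          · simpa [hj] using hwj
      have hzV : z ∈ V := fun j _ => by
        by_cases hj : j = i
        · simp [hj]
        · have := hz j (mem_univ j)
          simpa [hj] using this
      simpa [W'] using hVW hzV
  simpa using key Finset.univ

/-- Points of one fibre of `π_eq` are regionally proximal as a tuple, and they can be brought
together in any nonempty open set. -/
theorem exists_smul_mem_of_piEq_eq {m : ℕ} {U : Set X} (hU : IsOpen U) (hne : U.Nonempty)
    {y : MaxEquicontinuousFactor G X} {p : Fin m → X} (hp : ∀ i, piEq G X (p i) = y)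
    {V : Set (Fin m → X)} (hV : V ∈ 𝓝 p) : ∃ q ∈ V, ∃ g : G, ∀ i, g • q i ∈ U := by
  let O : Set (Fin m → X) := ⋃ g : G, {z | ∀ i, g • z i ∈ U}
  have hO (k : G) (z : Fin m → X) (hz : z ∈ O) : k • z ∈ O := by
    obtain ⟨g, hg⟩ := mem_iUnion.1 hz
    refine mem_iUnion.2 ⟨g * k⁻¹, fun i => ?_⟩
    simpa [mul_smul] using hg i
  have hinv (k : G) (z : Fin m → X) (hz : z ∈ closure O) : k • z ∈ closure O :=
    map_mem_closure (continuous_const_smul k) hz (hO k)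
  have hsub := pi_preimage_interior_subset (G := G) hU isClosed_closure hinv
    (fun z hz => subset_closure (mem_iUnion.2 ⟨1, fun i => by simpa using hz i (mem_univ i)⟩))
  obtain ⟨x, rfl⟩ := MaxEquicontinuousFactor.piEq_surjective y
  obtain ⟨g, hg⟩ := (isOpen_interior.preimage
    (MaxEquicontinuousFactor.continuous_piEq (G := G))).exists_smul_mem G x
    ((interior_image_piEq_nonempty (G := G) hU hne).preimage
      MaxEquicontinuousFactor.piEq_surjective)
  -- All coordinates of `p` have the same image `y`, so one `g` moves the entire tuple into the
  -- preimage of the interior.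
  have hgp : g • p ∈ closure O := hsub fun i _ => by
    change piEq G X (g • p i) ∈ interior (piEq G X '' U)
    rw [MaxEquicontinuousFactor.piEq_smul, hp i]
    exact hg
  have hpO : p ∈ closure O := by simpa using hinv g⁻¹ _ hgp
  obtain ⟨q, hqV, hqO⟩ := mem_closure_iff_nhds.1 hpO V hV
  obtain ⟨k, hk⟩ := mem_iUnion.1 hqO
  exact ⟨q, hqV, k, hk⟩

end Abelian

/-! ### Ranks in terms of tuples, and the two equivalences -/

section Ranks

variable {G : Type v} [CommGroup G] [TopologicalSpace G]
variable {X : Type u} [MetricSpace X]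

theorem exists_injective_fin_iff_le_encard {α : Type*} {s : Set α} {m : ℕ} :
    (∃ p : Fin m → α, (∀ i, p i ∈ s) ∧ Function.Injective p) ↔ (m : ℕ∞) ≤ s.encard := by
  constructor
  · rintro ⟨p, hp, hinj⟩
    have h := Set.encard_le_encard (range_subset_iff.2 hp)
    rwa [← image_univ, hinj.encard_image, encard_univ, ENat.card_eq_coe_fintype_card,
      Fintype.card_fin] at h
  · intro h
    obtain ⟨t, hts, ht⟩ := exists_subset_encard_eq h
    have hfin : t.Finite := finite_of_encard_eq_coe ht
    have hn : t.ncard = m := by rw [ncard_def, ht, ENat.toNat_natCast]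
    have := hfin.to_subtype
    let e := (Finite.equivFinOfCardEq (α := t) hn).symm
    exact ⟨fun i => e i, fun i => hts (e i).2, Subtype.val_injective.comp e.injective⟩

variable [MulAction G X]

/-- Discarding points keeps the others pairwise non-proximal, so the admissible sizes are downward
closed and it suffices to test size `m`. -/
theorem coincidenceRank_lt_iff {y : MaxEquicontinuousFactor G X} {m : ℕ} (hm : m ≠ 0) :
    coincidenceRank G y < (m : ℕ∞) ↔ ¬ ∃ p : Fin m → X, (∀ i, piEq G X (p i) = y) ∧
      ∀ i j, i ≠ j → ¬ IsProximal G (p i) (p j) := by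
  constructor
  · intro h hp
    exact (lt_self_iff_false _).1 ((le_iSup₂ (f := fun (n : ℕ) (_ : ∃ x : Fin n → X,
      (∀ i, piEq G X (x i) = y) ∧ ∀ i j, i ≠ j → ¬ IsProximal G (x i) (x j)) => (n : ℕ∞))
      m hp).trans_lt h)
  · intro h
    have hle : coincidenceRank G y ≤ ((m - 1 : ℕ) : ℕ∞) := by
      refine iSup₂_le fun n hn => ?_
      obtain ⟨p, hp, hpp⟩ := hn
      by_contra! hlt
      have hmn : m ≤ n := by
        have := Nat.cast_lt.1 hlt
        omega
      exact h ⟨fun i => p (Fin.castLE hmn i), fun i => hp _,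
        fun i j hij => hpp _ _ fun e => hij (Fin.castLE_injective hmn e)⟩
    exact hle.trans_lt (Nat.cast_lt.2 (by omega))

theorem maximalRank_le_iff {m : ℕ} (hm : m ≠ 0) :
    maximalRank G X ≤ ((m - 1 : ℕ) : ℕ∞) ↔ ¬ ∃ p : Fin m → X,
      (∀ i j, piEq G X (p i) = piEq G X (p j)) ∧ Function.Injective p := by
  have hlt (k : ℕ∞) : k ≤ ((m - 1 : ℕ) : ℕ∞) ↔ ¬ (m : ℕ∞) ≤ k := by
    obtain ⟨n, rfl⟩ := Nat.exists_eq_succ_of_ne_zero hm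
    induction k using ENat.recTopCoe with
    | top => simp
    | coe k => simp only [Nat.cast_le]; omega
  unfold maximalRank
  rw [iSup_le_iff]
  simp only [hlt, ← exists_injective_fin_iff_le_encard]
  constructor
  · rintro h ⟨p, hp, hinj⟩
    exact h (piEq G X (p ⟨0, Nat.pos_of_ne_zero hm⟩)) ⟨p, fun i => hp _ _, hinj⟩
  · rintro h y ⟨p, hp, hinj⟩
    exact h ⟨p, fun i j => (hp i).trans (hp j).symm, hinj⟩

variable [CompactSpace X]

/-- Limits of translates of tuples that converge to a single point lie in one fibre of `π_eq`. -/
theorem piEq_eq_of_tendsto {ι : Type*} {l : Filter ι} [l.NeBot] {a b : ι → X} {g : ι → G}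
    {x z w : X} (ha : Tendsto a l (𝓝 x)) (hb : Tendsto b l (𝓝 x))
    (hz : Tendsto (fun n => g n • a n) l (𝓝 z)) (hw : Tendsto (fun n => g n • b n) l (𝓝 w)) :
    piEq G X z = piEq G X w := by
  have hc := MaxEquicontinuousFactor.continuous_piEq (G := G) (X := X)
  have heq := Metric.uniformEquicontinuous_iff.1
    (MaxEquicontinuousFactor.isEquicontinuousAction (G := G) (X := X))
  have hab : Tendsto (fun n => dist (piEq G X (a n)) (piEq G X (b n))) l (𝓝 0) := by
    simpa using ((hc.tendsto x).comp ha).dist ((hc.tendsto x).comp hb)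
  have hzw : Tendsto (fun n => dist (piEq G X (g n • a n)) (piEq G X (g n • b n))) l
      (𝓝 (dist (piEq G X z) (piEq G X w))) :=
    ((hc.tendsto z).comp hz).dist ((hc.tendsto w).comp hw)
  -- Equicontinuity on `X_eq` is uniform over the group, so the varying `g n` cannot separate the
  -- images.
  have h0 : Tendsto (fun n => dist (piEq G X (g n • a n)) (piEq G X (g n • b n))) l (𝓝 0) := by
    refine Metric.tendsto_nhds.2 fun ε hε => ?_
    obtain ⟨δ, hδ, h⟩ := heq ε hε
    filter_upwards [hab.eventually_lt_const hδ] with n hn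
    simpa [MaxEquicontinuousFactor.piEq_smul] using h _ _ hn (g n)
  exact dist_eq_zero.1 (tendsto_nhds_unique hzw h0)

/-- Cluster points of translates of tuples that shrink to a single point. -/
theorem exists_piEq_eq_of_mem_ball {m : ℕ} {x : X} {p : ℕ → Fin m → X} {g : ℕ → G}
    (hp : ∀ n i, dist (p n i) x < 1 / ((n : ℝ) + 1)) :
    ∃ (l : Ultrafilter ℕ) (z : Fin m → X), (l : Filter ℕ) ≤ atTop ∧
      (∀ i j, piEq G X (z i) = piEq G X (z j)) ∧
      ∀ i, Tendsto (fun n => g n • p n i) l (𝓝 (z i)) := by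
  obtain ⟨z, -, hz⟩ := isCompact_univ.ultrafilter_le_nhds
    ((hyperfilter ℕ).map fun n => g n • p n) (by simp)
  have hz' : Tendsto (fun n => g n • p n) (hyperfilter ℕ) (𝓝 z) := hz
  rw [tendsto_pi_nhds] at hz'
  have hlim (i : Fin m) : Tendsto (fun n => p n i) (hyperfilter ℕ) (𝓝 x) := by
    refine tendsto_iff_dist_tendsto_zero.2 ?_
    exact squeeze_zero (fun _ => dist_nonneg) (fun n => (hp n i).le)
      (tendsto_one_div_add_atTop_nhds_zero_nat.mono_left Nat.hyperfilter_le_atTop)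
  exact ⟨hyperfilter ℕ, z, Nat.hyperfilter_le_atTop,
    fun i j => piEq_eq_of_tendsto (hlim i) (hlim j) (hz' i) (hz' j), hz'⟩

/-- An action whose fibres over the maximal equicontinuous factor have less than `m` points is
`m`-equicontinuous. -/
theorem isMEquicontinuous_of_fibre {m : ℕ}
    (h : ¬ ∃ p : Fin m → X, (∀ i j, piEq G X (p i) = piEq G X (p j)) ∧ Function.Injective p) :
    IsMEquicontinuous G X m := by
  intro x ε hε
  by_contra! hcon
  choose p hp g hg using fun n : ℕ => hcon (1 / ((n : ℝ) + 1)) Nat.one_div_pos_of_nat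
  obtain ⟨l, z, -, hπ, hz⟩ := exists_piEq_eq_of_mem_ball (g := g) hp
  refine h ⟨z, hπ, fun i j hij => ?_⟩
  by_contra hne
  have : ε ≤ dist (z i) (z j) :=
    ge_of_tendsto ((hz i).dist (hz j)) (Eventually.of_forall fun n => hg n i j hne)
  rw [hij, dist_self] at this
  linarith

variable [ContinuousSMul G X] [MulAction.IsMinimal G X]

/-- The fibres of `π_eq` of a minimal `m`-equicontinuous action of an abelian group have less than
`m` points. -/
theorem not_injective_of_isMEquicontinuous {m : ℕ} (hm : m ≠ 0) (h : IsMEquicontinuous G X m) :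
    ¬ ∃ p : Fin m → X, (∀ i j, piEq G X (p i) = piEq G X (p j)) ∧ Function.Injective p := by
  rintro ⟨p, hp, hinj⟩
  obtain ⟨ε, hε, hsep⟩ : ∃ ε > 0, ∀ᶠ q in 𝓝 p, ∀ i j, i ≠ j → ε ≤ dist (q i) (q j) := by
    have hpos : ∀ i j, ∃ ε > 0, ∀ᶠ q in 𝓝 p, i ≠ j → ε ≤ dist (q i) (q j) := by
      intro i j
      by_cases hij : i = j
      · exact ⟨1, one_pos, by simp [hij]⟩
      · have hd : 0 < dist (p i) (p j) := dist_pos.2 (hinj.ne hij)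
        refine ⟨dist (p i) (p j) / 2, half_pos hd, ?_⟩
        have hc : Continuous fun q : Fin m → X => dist (q i) (q j) := by fun_prop
        filter_upwards [(hc.tendsto p).eventually_const_lt (half_lt_self hd)] with q hq _
        exact hq.le
    choose e he hev using hpos
    have hne : (Finset.univ : Finset (Fin m × Fin m)).Nonempty :=
      ⟨(⟨0, Nat.pos_of_ne_zero hm⟩, ⟨0, Nat.pos_of_ne_zero hm⟩), Finset.mem_univ _⟩
    refine ⟨Finset.univ.inf' hne fun q => e q.1 q.2, (Finset.lt_inf'_iff _).2 fun q _ => he _ _, ?_⟩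
    filter_upwards [eventually_all.2 fun i => eventually_all.2 fun j => hev i j] with q hq i j hij
    exact (Finset.inf'_le _ (Finset.mem_univ (i, j))).trans (hq i j hij)
  let i₀ : Fin m := ⟨0, Nat.pos_of_ne_zero hm⟩
  obtain ⟨δ, hδ, hball⟩ := h (p i₀) ε hε
  obtain ⟨q, hq, g, hg⟩ := exists_smul_mem_of_piEq_eq (G := G) (Metric.isOpen_ball (ε := δ))
    ⟨p i₀, Metric.mem_ball_self hδ⟩ (fun i => hp i i₀) hsep
  obtain ⟨i, j, hij, hlt⟩ := hball (fun i => g • q i) hg g⁻¹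
  rw [inv_smul_smul, inv_smul_smul] at hlt
  exact (hq i j hij).not_gt hlt

/-- An action with less than `m` pairwise non-proximal points in one fibre of `π_eq` is cover
`m`-equicontinuous. -/
theorem isCoverMEquicontinuous_of_fibre [SigmaCompactSpace G] {m : ℕ} (hm : m ≠ 0)
    {y : MaxEquicontinuousFactor G X}
    (h : ¬ ∃ p : Fin m → X, (∀ i, piEq G X (p i) = y) ∧
      ∀ i j, i ≠ j → ¬ IsProximal G (p i) (p j)) :
    IsCoverMEquicontinuous G X m := by
  intro x ε hε
  by_contra! hcon
  have hex (n : ℕ) : ∃ (p : Fin m → X) (g : G), (∀ i, dist (p i) x < 1 / ((n : ℝ) + 1)) ∧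
      ∀ k ∈ compactCovering G n, ∀ i j, i ≠ j → ε < dist (k⁻¹ • g • p i) (k⁻¹ • g • p j) := by
    obtain ⟨p, hp, hA⟩ := hcon (Metric.ball x (1 / ((n : ℝ) + 1))) Metric.isOpen_ball
      (Metric.mem_ball_self Nat.one_div_pos_of_nat) _ (isCompact_compactCovering G n)
    unfold IsCoveringSet at hA
    push Not at hA
    obtain ⟨g, hg⟩ := hA
    refine ⟨p, g, hp, fun k hk i j hij => ?_⟩
    by_contra! hle
    refine hg k hk (k⁻¹ * g) ⟨i, j, hij, ?_⟩ (mul_inv_cancel_left k g)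
    rwa [mul_smul, mul_smul]
  choose p g hp hg using hex
  obtain ⟨l, z, hl, hπ, hz⟩ := exists_piEq_eq_of_mem_ball (g := g) hp
  have hsep (k : G) (i j : Fin m) (hij : i ≠ j) : ε ≤ dist (k • z i) (k • z j) := by
    obtain ⟨N, hN⟩ := exists_mem_compactCovering k⁻¹
    have hk := continuous_const_smul (T := X) k
    refine ge_of_tendsto (((hk.tendsto _).comp (hz i)).dist ((hk.tendsto _).comp (hz j))) ?_
    filter_upwards [hl (eventually_ge_atTop N)] with n hn
    simpa using (hg n k⁻¹ (compactCovering_subset G hn hN) i j hij).le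
  let i₀ : Fin m := ⟨0, Nat.pos_of_ne_zero hm⟩
  obtain ⟨a, ha⟩ := MaxEquicontinuousFactor.piEq_surjective y
  let O : Set (Fin m → X) := range fun k : G => k • z
  have himg : (fun w : Fin m → X => w i₀) '' closure O = univ := by
    have hcl : IsClosed ((fun w : Fin m → X => w i₀) '' closure O) :=
      (isClosed_closure.isCompact.image (continuous_apply i₀)).isClosed
    refine univ_subset_iff.1 ((MulAction.dense_orbit G (z i₀)).closure_eq.symm.subset.trans
      (hcl.closure_subset_iff.2 ?_))
    rintro _ ⟨k, rfl⟩
    exact ⟨k • z, subset_closure ⟨k, rfl⟩, rfl⟩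
  obtain ⟨w, hw, hwa⟩ : a ∈ (fun w : Fin m → X => w i₀) '' closure O := himg ▸ mem_univ a
  have hc := MaxEquicontinuousFactor.continuous_piEq (G := G) (X := X)
  refine h ⟨w, fun i => ?_, fun i j hij hprox => ?_⟩
  · have hcl : IsClosed {w : Fin m → X | piEq G X (w i) = piEq G X (w i₀)} :=
      isClosed_eq (hc.comp (continuous_apply i)) (hc.comp (continuous_apply i₀))
    have : w ∈ {w : Fin m → X | piEq G X (w i) = piEq G X (w i₀)} := by
      refine closure_minimal ?_ hcl hw
      rintro _ ⟨k, rfl⟩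
      change piEq G X (k • z i) = piEq G X (k • z i₀)
      rw [MaxEquicontinuousFactor.piEq_smul, MaxEquicontinuousFactor.piEq_smul, hπ i i₀]
    rw [this.out, ← ha, ← hwa]
  · obtain ⟨k, hk⟩ := hprox ε hε
    have hcl : IsClosed {w : Fin m → X | ε ≤ dist (k • w i) (k • w j)} :=
      isClosed_le continuous_const
        (((continuous_apply i).const_smul k).dist ((continuous_apply j).const_smul k))
    have : w ∈ {w : Fin m → X | ε ≤ dist (k • w i) (k • w j)} := by
      refine closure_minimal ?_ hcl hw
      rintro _ ⟨k', rfl⟩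
      simpa [mul_smul] using hsep (k * k') i j hij
    exact hk.not_ge this

/-- A fibre of `π_eq` of a minimal cover `m`-equicontinuous action of an abelian group has less
than `m` pairwise non-proximal points. -/
theorem not_pairwise_not_isProximal_of_isCoverMEquicontinuous [IsTopologicalGroup G]
    {m : ℕ} (hm : m ≠ 0)
    (h : IsCoverMEquicontinuous G X m) {y : MaxEquicontinuousFactor G X} :
    ¬ ∃ p : Fin m → X, (∀ i, piEq G X (p i) = y) ∧
      ∀ i j, i ≠ j → ¬ IsProximal G (p i) (p j) := by
  rintro ⟨p, hp, hprox⟩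
  let i₀ : Fin m := ⟨0, Nat.pos_of_ne_zero hm⟩
  obtain ⟨ε, hε, hsep⟩ : ∃ ε > 0, ∀ i j, i ≠ j → ∀ g : G, ε < dist (g • p i) (g • p j) := by
    have hpos : ∀ i j, ∃ ε > 0, i ≠ j → ∀ g : G, ε ≤ dist (g • p i) (g • p j) := by
      intro i j
      by_cases hij : i = j
      · exact ⟨1, one_pos, by simp [hij]⟩
      · have := hprox i j hij
        unfold IsProximal at this
        push Not at this
        obtain ⟨ε, hε, hg⟩ := this
        exact ⟨ε, hε, fun _ => hg⟩
    choose e he hev using hpos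
    have hne : (Finset.univ : Finset (Fin m × Fin m)).Nonempty := ⟨(i₀, i₀), Finset.mem_univ _⟩
    have hinf : 0 < Finset.univ.inf' hne fun q => e q.1 q.2 :=
      (Finset.lt_inf'_iff _).2 fun q _ => he _ _
    refine ⟨_, half_pos hinf, fun i j hij g => (half_lt_self hinf).trans_le ?_⟩
    exact (Finset.inf'_le _ (Finset.mem_univ (i, j))).trans (hev i j hij g)
  obtain ⟨U, hU, hpU, K, hK, hcov⟩ := h (p i₀) ε hε
  have hnear : ∀ᶠ q in 𝓝 p, ∀ k ∈ K, ∀ i j, i ≠ j → ε < dist (k⁻¹ • q i) (k⁻¹ • q j) := by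
    refine hK.eventually_forall_of_forall_eventually fun k _ => ?_
    refine eventually_all.2 fun i => eventually_all.2 fun j => ?_
    by_cases hij : i = j
    · simp [hij]
    · have hc : Continuous fun r : (Fin m → X) × G => dist (r.2⁻¹ • r.1 i) (r.2⁻¹ • r.1 j) := by
        fun_prop
      filter_upwards [(hc.tendsto (p, k)).eventually_const_lt (hsep i j hij k⁻¹)] with r hr _
      exact hr
  obtain ⟨q, hq, g, hg⟩ := exists_smul_mem_of_piEq_eq (G := G) hU ⟨p i₀, hpU⟩ hp hnear
  obtain ⟨k, hk, a, ⟨i, j, hij, hle⟩, hka⟩ := hcov (fun i => g • q i) hg g⁻¹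
  have ha : a = k⁻¹ * g⁻¹ := by rw [← hka, inv_mul_cancel_left]
  rw [ha, mul_smul, mul_smul, inv_smul_smul, inv_smul_smul] at hle
  exact (hq k hk i j hij).not_ge hle

end Ranks

end TopDyn

theorem theorem1p1 (G : Type v) [CommGroup G] [TopologicalSpace G] [IsTopologicalGroup G]
    [LocallyCompactSpace G] [SigmaCompactSpace G]
    (X : Type u) [MetricSpace X] [CompactSpace X]
    [MulAction G X] [ContinuousSMul G X] [MulAction.IsMinimal G X]
    (m : ℕ) (hm : 2 ≤ m) :
    (TopDyn.IsMEquicontinuous G X m ↔ TopDyn.maximalRank G X ≤ ((m - 1 : ℕ) : ℕ∞)) ∧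
      ∀ y : TopDyn.MaxEquicontinuousFactor G X,
        (TopDyn.IsCoverMEquicontinuous G X m ↔ TopDyn.coincidenceRank G y < (m : ℕ∞)) := by
  have hm0 : m ≠ 0 := by omega
  refine ⟨?_, fun y => ?_⟩
  · rw [TopDyn.maximalRank_le_iff hm0]
    exact ⟨TopDyn.not_injective_of_isMEquicontinuous hm0, TopDyn.isMEquicontinuous_of_fibre⟩
  · rw [TopDyn.coincidenceRank_lt_iff hm0]
    exact ⟨fun h => TopDyn.not_pairwise_not_isProximal_of_isCoverMEquicontinuous hm0 h,
      TopDyn.isCoverMEquicontinuous_of_fibre hm0⟩
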